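/- **Conventions.** A *categorical group* (coherent 2-group) is a monoidal groupoid $\mathsf C=(C_0,C_1,d_0,d_1,i,m)$, with monoidal sum $+$, zero object $0$ and natural isomorphisms $\alpha_{x,y,z}\colon (x+y)+z\to x+(y+z)$, $\lambda_x\colon 0+x\to x$, $\rho_x\colon x+0\to x$, in which every object $x$ has a chosen opposite $-x$ and isomorphisms $\epsilon_x\colon -x+x\to 0$, $\delta_x\colon x+(-x)\to 0$ such that $(1_x+\epsilon_x)\,\alpha_{x,-x,x}\,(\delta_x^{-1}+1_x)=\rho_x^{-1}\lambda_x$ and $(\epsilon_x+1_{-x})\,\alpha^{-1}_{-x,x,-x}\,(1_{-x}+\delta_x^{-1})=\lambda_{-x}^{-1}\rho_{-x}$. For $f\colon x\to x'$, $-f\colon -x\to -x'$ denotes the morphism $\lambda_{-x'}(\epsilon_x+1_{-x'})\,\alpha^{-1}_{-x,x,-x'}\,(1_{-x}+(f^{-1}+1_{-x'}))(1_{-x}+\delta_{x'}^{-1})\rho_{-x}^{-1}$, for which $\epsilon$ and $\delta$ are natural. Arrows $f,g$ are *isomorphic*, $f\approx g$, if there are isomorphisms $\theta_j\colon d_j(f)\to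 d_j(g)$, $j=0,1$, with $\theta_1f=g\theta_0$. *Special isomorphisms* are taken between formal expressions. Expressions are the words built from objects of $\mathsf C$ and $0$ by $+$ and $-$; each word $w$ has a value $|w|\in C_0$. Special isomorphisms $w\to w'$ are the morphisms $|w|\to|w'|$ obtained from identities and the components of $\alpha,\lambda,\rho,\epsilon,\delta$ (indexed by words) by inverses, compositions and sums. A *c-group* is a set with an equivalence relation $\sim$, a sum compatible with $\sim$, an element $0$ and opposites $-a$, such that $a+(b+c)\sim(a+b)+c$, $a+0\sim a\sim 0+a$ and $a+(-a)\sim0\sim-a+a$; we write $a-b$ for $a+(-b)$. A *morphism* of c-groups preserves $\sim$, and preserves sums up to equality. An *action* of a c-group $H$ on a c-group $G$ is a map $(b,a)\mapsto b\cdot a$ with $b\cdot(a+a_1)\sim b\cdot a+b\cdot a_1$, $(b+b_1)\cdot a\sim b\cdot(b_1\cdot a)$, $0\cdot a\sim a$, and $b\cdot a\sim b_1\cdot a_1$ whenever $a\sim a_1$ and $b\sim b_1$. A *c-crossed module* $(G,H,\partial)$ consists of c-groups $G,H$, a morphism $\partial\colon G\to H$ and an action of $H$ on $G$ such that (i) $\partial(b\cdot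 a)=b+(\partial a-b)$ and (ii) $\partial(a)\cdot a_1\sim a+(a_1-a)$. It is *connected* if $a\sim a'$ for all $a,a'\in G$, and *strict* if (i) and (ii) both hold with equality. **Theorem.** Let $\mathsf C$ be a categorical group. Let $C_0$ carry $+$, $0$, $-$ and the relation of being isomorphic, and let $d$ be the codomain map on $c\mathbf{K}er\,d_0=\{f\in C_1\mid d_0(f)=0\}$. There are unique special isomorphisms $\gamma\colon 0\to 0+0$, $\kappa\colon 0\to -0$ and, for each $r\in C_0$, $\gamma_r\colon 0\to r+(0+(-r))$ between the displayed expressions. Equip $c\mathbf{K}er\,d_0$ with the relation $\approx$ of isomorphism of arrows as $\sim$, the sum of $c,c'$ being $(c+c')\gamma$, the zero $1_0$, the opposite of $c$ being $(-c)\kappa$, and the action of $C_0$ given by $r\cdot c=(1_r+(c+(-1_r)))\gamma_r$. Then $(c\mathbf{K}er\,d_0,C_0,d)$ is a c-crossed module which is connected, strict and special. Here *special* means: 1. for every $c\in c\mathbf{K}er\,d_0$, $r\in C_0$ and isomorphism $\gamma\colon d(c)\to r$ there is $c'\sim c$ with $d(c')=r$; moreover $c'$ can be chosen so that there is an isomorphism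 of arrows $(\theta_0,\theta_1)\colon c\approx c'$ with $\theta_0$ a special isomorphism from the expression $0$ to itself and $\theta_1=\gamma$; 2. if $\gamma\colon d(c)\to r$ is a special isomorphism from $w$ to $w'$, for words $w,w'$ with $|w|=d(c)$ and $|w'|=r$, then there is exactly one $c'\in c\mathbf{K}er\,d_0$ with $d(c')=r$ which is weak equivalent to $c$ with respect to $w,w'$, i.e. for which there is an isomorphism of arrows $(\theta_0,\theta_1)\colon c\approx c'$ with $\theta_0$ a special isomorphism from the expression $0$ to itself and $\theta_1$ a special isomorphism from $w$ to $w'$. -/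

import Mathlib

open CategoryTheory MonoidalCategory

universe v u w

/-! ## Groups up to congruence relation and c-crossed modules -/

/-- The data of a c-group: a relation, a sum, a zero element and a choice of opposites. -/
structure CGroupData (G : Type u) where
  rel : G → G → Prop
  add : G → G → G
  zero : G
  neg : G → G

/-- The axioms of a c-group (group up to congruence relation). -/
structure IsCGroup {A : Type u} (G : CGroupData A) : Prop where
  equivalence : Equivalence G.rel
  add_congr : ∀ {a a' b b' : A}, G.rel a a' → G.rel b b' → G.rel (G.add a b) (G.add a' b')
  add_assoc : ∀ a b c : A, G.rel (G.add a (G.add b c)) (G.add (G.add a b) c)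
  add_zero : ∀ a : A, G.rel (G.add a G.zero) a
  zero_add : ∀ a : A, G.rel (G.add G.zero a) a
  add_neg : ∀ a : A, G.rel (G.add a (G.neg a)) G.zero
  neg_add : ∀ a : A, G.rel (G.add (G.neg a) a) G.zero

/-- A morphism of c-groups preserves the congruence relation, and preserves sums strictly. -/
structure IsCGroupHom {A : Type u} {B : Type w} (G : CGroupData A) (H : CGroupData B)
    (f : A → B) : Prop where
  map_rel : ∀ {a a' : A}, G.rel a a' → H.rel (f a) (f a')
  map_add : ∀ a a' : A, f (G.add a a') = H.add (f a) (f a')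

/-- An action of the c-group `H` on the c-group `G`. -/
structure IsCAction {A : Type u} {B : Type w} (G : CGroupData A) (H : CGroupData B)
    (act : B → A → A) : Prop where
  act_add : ∀ (b : B) (a a₁ : A), G.rel (act b (G.add a a₁)) (G.add (act b a) (act b a₁))
  add_act : ∀ (b b₁ : B) (a : A), G.rel (act (H.add b b₁) a) (act b (act b₁ a))
  zero_act : ∀ a : A, G.rel (act H.zero a) a
  act_congr : ∀ {b b₁ : B} {a a₁ : A}, G.rel a a₁ → H.rel b b₁ → G.rel (act b a) (act b₁ a₁)

/-- `(G, H, bd)` with the action `act` is a c-crossed module. -/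
structure IsCCrossedModule {A : Type u} {B : Type w} (G : CGroupData A) (H : CGroupData B)
    (bd : A → B) (act : B → A → A) : Prop where
  isCGroup_left : IsCGroup G
  isCGroup_right : IsCGroup H
  isCGroupHom : IsCGroupHom G H bd
  isCAction : IsCAction G H act
  bd_act : ∀ (b : B) (a : A), bd (act b a) = H.add b (H.add (bd a) (H.neg b))
  bd_act_rel : ∀ a a₁ : A, G.rel (act (bd a) a₁) (G.add a (G.add a₁ (G.neg a)))

/-- A c-group is connected if any two of its elements are congruent. -/
def IsConnectedCGroup {A : Type u} (G : CGroupData A) : Prop :=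
  ∀ a a' : A, G.rel a a'

/-- Strictness: both conditions of a c-crossed module hold with equality. -/
structure IsStrictCCrossedModule {A : Type u} {B : Type w} (G : CGroupData A) (H : CGroupData B)
    (bd : A → B) (act : B → A → A) : Prop where
  bd_act : ∀ (b : B) (a : A), bd (act b a) = H.add b (H.add (bd a) (H.neg b))
  bd_act_eq : ∀ a a₁ : A, act (bd a) a₁ = G.add a (G.add a₁ (G.neg a))

/-! ## Categorical groups

The monoidal sum `x + y` is written `x ⊗ y`, the zero object is `𝟙_ C`. -/

/-- A categorical group (coherent 2-group): a monoidal groupoid with a chosen opposite `neg x` of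
every object `x`, and isomorphisms `ε x : -x + x ≅ 0`, `δ x : x + (-x) ≅ 0` making the two
triangle diagrams commute. -/
class CategoricalGroup (C : Type u) [Groupoid.{v} C] [MonoidalCategory C] where
  neg : C → C
  ε : ∀ x : C, neg x ⊗ x ≅ 𝟙_ C
  δ : ∀ x : C, x ⊗ neg x ≅ 𝟙_ C
  triangle_left : ∀ x : C,
    (δ x).inv ▷ x ≫ (α_ x (neg x) x).hom ≫ x ◁ (ε x).hom = (λ_ x).hom ≫ (ρ_ x).inv
  triangle_right : ∀ x : C,
    neg x ◁ (δ x).inv ≫ (α_ (neg x) x (neg x)).inv ≫ (ε x).hom ▷ neg x =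
      (ρ_ (neg x)).hom ≫ (λ_ (neg x)).inv

namespace CategoricalGroup

section

variable {C : Type u} [Groupoid.{v} C] [MonoidalCategory C] [CategoricalGroup C]

/-- The opposite `-f : -x ⟶ -x'` of a morphism `f : x ⟶ x'`. It is the composite
`-x ≅ -x + 0 ≅ -x + (x' + (-x')) ⟶ -x + (x + (-x')) ≅ (-x + x) + (-x') ≅ 0 + (-x') ≅ -x'`,
and is the morphism for which `ε` and `δ` are natural. -/
def negHom {x x' : C} (f : x ⟶ x') : neg x ⟶ neg x' :=
  (ρ_ (neg x)).inv ≫ neg x ◁ (δ x').inv ≫ neg x ◁ Groupoid.inv f ▷ neg x' ≫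
    (α_ (neg x) x (neg x')).inv ≫ (ε x).hom ▷ neg x' ≫ (λ_ (neg x')).hom

variable (C)

/-- Group words in the objects of `C`. -/
inductive Word : Type u
  | of (x : C) : Word
  | zero : Word
  | add (w w' : Word) : Word
  | neg (w : Word) : Word

variable {C}

/-- The object of `C` denoted by a word. -/
def Word.obj : Word C → C
  | .of x => x
  | .zero => 𝟙_ C
  | .add w w' => w.obj ⊗ w'.obj
  | .neg w => CategoricalGroup.neg w.obj

/-- The special isomorphisms between (the values of) two words: those obtained from identities and
the components of `α`, `λ`, `ρ`, `ε`, `δ` by inverses, compositions and sums. -/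
inductive Special : (w w' : Word C) → (w.obj ⟶ w'.obj) → Prop
  | id (w : Word C) : Special w w (𝟙 w.obj)
  | comp {w w' w'' : Word C} {f : w.obj ⟶ w'.obj} {g : w'.obj ⟶ w''.obj} :
      Special w w' f → Special w' w'' g → Special w w'' (f ≫ g)
  | inv {w w' : Word C} {f : w.obj ⟶ w'.obj} : Special w w' f → Special w' w (Groupoid.inv f)
  | sum {w w' t t' : Word C} {f : w.obj ⟶ w'.obj} {g : t.obj ⟶ t'.obj} :
      Special w w' f → Special t t' g → Special (w.add t) (w'.add t') (f ⊗ₘ g)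
  | assoc (w w' w'' : Word C) :
      Special ((w.add w').add w'') (w.add (w'.add w'')) (α_ w.obj w'.obj w''.obj).hom
  | zero_add (w : Word C) : Special (Word.zero.add w) w (λ_ w.obj).hom
  | add_zero (w : Word C) : Special (w.add Word.zero) w (ρ_ w.obj).hom
  | neg_add (w : Word C) : Special (w.neg.add w) Word.zero (ε w.obj).hom
  | add_neg (w : Word C) : Special (w.add w.neg) Word.zero (δ w.obj).hom

/-- `γ : x ⟶ y` is a special isomorphism for the expressions `w` of `x` and `w'` of `y`. -/
def IsSpecialFor (w w' : Word C) {x y : C} (γ : x ⟶ y) : Prop :=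
  ∃ (hx : w.obj = x) (hy : w'.obj = y), Special w w' (eqToHom hx ≫ γ ≫ eqToHom hy.symm)

variable (C)

/-- The c-group of objects of a categorical group; objects are congruent if isomorphic. -/
def objCGroup : CGroupData C where
  rel x y := Nonempty (x ≅ y)
  add x y := x ⊗ y
  zero := 𝟙_ C
  neg x := neg x

/-- The set of arrows whose domain is exactly the zero object. -/
@[ext] structure CKer where
  cod : C
  hom : 𝟙_ C ⟶ cod

/-- The special isomorphism `0 ≅ 0 + 0`. -/
def sumCorr : 𝟙_ C ⟶ 𝟙_ C ⊗ 𝟙_ C := (λ_ (𝟙_ C)).inv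

/-- The special isomorphism `0 ≅ -0`. -/
def negCorr : 𝟙_ C ⟶ neg (𝟙_ C) := (δ (𝟙_ C)).inv ≫ (λ_ (neg (𝟙_ C))).hom

variable {C}

/-- The special isomorphism `0 ≅ r + (0 - r)`. -/
def actCorr (r : C) : 𝟙_ C ⟶ r ⊗ (𝟙_ C ⊗ neg r) := (δ r).inv ≫ r ◁ (λ_ (neg r)).inv

variable (C)

/-- The c-group structure on the arrows with domain `0`: elements are congruent if they are
isomorphic as arrows of `C`; sum and opposite are those of arrows, corrected by special
isomorphisms. -/
def kerCGroup : CGroupData (CKer C) where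
  rel c c' := Nonempty (Arrow.mk c.hom ≅ Arrow.mk c'.hom)
  add c c' := ⟨c.cod ⊗ c'.cod, sumCorr C ≫ (c.hom ⊗ₘ c'.hom)⟩
  zero := ⟨𝟙_ C, 𝟙 (𝟙_ C)⟩
  neg c := ⟨neg c.cod, negCorr C ≫ negHom c.hom⟩

/-- The codomain map. -/
def kerD (c : CKer C) : C := c.cod

/-- The action `r · c = (i(r) + (c - i(r))) γ` with `γ : 0 ≅ r + (0 - r)` special. -/
def kerAct (r : C) (c : CKer C) : CKer C :=
  ⟨r ⊗ (c.cod ⊗ neg r), actCorr r ≫ (𝟙 r ⊗ₘ (c.hom ⊗ₘ negHom (𝟙 r)))⟩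

variable {C}

/-- `σ : d c ⟶ d c'` is the codomain part of an isomorphism of arrows `c ≅ c'` whose domain part
is a special isomorphism `0 ≅ 0`. -/
def KerOver (c c' : CKer C) (σ : kerD C c ⟶ kerD C c') : Prop :=
  ∃ θ : Arrow.mk c.hom ≅ Arrow.mk c'.hom,
    IsSpecialFor Word.zero Word.zero θ.hom.left ∧ θ.hom.right = σ

/-- `a` and `a'` are weak equivalent, with respect to the expressions `t` of `bd a` and `t'` of
`bd a'`: there is a congruence between `a` and `a'` which lies over a special isomorphism.
Here `Over a a' σ` says that the isomorphism `σ` underlies a congruence between `a` and `a'`. -/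
def WeakEquivalent {A : Type w} (bd : A → C) (Over : ∀ a a' : A, (bd a ⟶ bd a') → Prop)
    (t t' : Word C) (a a' : A) : Prop :=
  ∃ σ : bd a ⟶ bd a', Over a a' σ ∧ IsSpecialFor t t' σ

/-- The condition that a c-crossed module with values in the c-group of objects of `C` is special:
every congruence `γ : bd a ≅ r` lifts to a congruence of `a` with some `a'` such that `bd a' = r`,
and if `γ` is special then there is a unique such `a'` which is weak equivalent to `a`. -/
structure IsSpecialCCrossedModule {A : Type w} (G : CGroupData A) (bd : A → C)
    (Over : ∀ a a' : A, (bd a ⟶ bd a') → Prop) : Prop where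
  exists_lift : ∀ (a : A) (r : C) (γ : bd a ⟶ r),
    ∃ a' : A, G.rel a' a ∧ ∃ h : bd a' = r, Over a a' (γ ≫ eqToHom h.symm)
  existsUnique_lift : ∀ (a : A) (r : C) (γ : bd a ⟶ r) (t t' : Word C), IsSpecialFor t t' γ →
    ∃! a' : A, bd a' = r ∧ WeakEquivalent bd Over t t' a a'

end

end CategoricalGroup

/-!
The heart of the matter is coherence for categorical groups: two special isomorphisms between the
same two words are equal (`Special.unique`). Given it, the rest is short.

*Coherence.* Choose a representative `rep g` of every isomorphism class `g` of objects. A word `w`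
acts on classes by tensoring on the right, and `translate w g g'` is an isomorphism
`rep g ⊗ |w| ⟶ rep g'`, where `g'` is the class of `rep g ⊗ |w|`. On one-letter words it is an
arbitrary choice, on `0` and on sums it is built from `ρ` and `α`, and on `-w` it is built from
the inverse of the translation by `w` and from `δ`. These translations are natural in every special
isomorphism `f : w ⟶ w'`, that is, `rep g ◁ f ≫ translate w' = translate w`
(`Special.whiskerLeft_comp_translate`). The generators reduce to the pentagon, the triangle and the
triangle identity relating `ε` and `δ`; nothing is needed from the choices on letters,
since every generator is uniform in the words it is indexed by. As the translations are invertible,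
`rep g ◁ f` depends only on `w` and `w'`, and for `rep g ≅ 0` so does `f`.

*The crossed module.* In a groupoid any two arrows out of `0` are isomorphic, so every axiom that
holds up to congruence of arrows is automatic. The equality `∂(a)·a₁ = a + (a₁ - a)` comes from
the naturality of `δ`, applied to an arrow `0 ⟶ ∂a` (`tensorHom_negHom_comp_δ`). By coherence the
domain part of an isomorphism of arrows over `σ` is the identity of `0`, so a congruence from `c` to
`c'` lies over `σ` exactly when `c' = σ ∘ c` (`kerOver_iff`); the lift of `c` along `γ` is `γ ∘ c`,
and a second application of coherence makes it unique when `γ` is special.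
-/

namespace CategoricalGroup

section

variable {C : Type u} [Groupoid.{v} C]

/-! ### Representatives of isomorphism classes -/

/-- The chosen representative of an isomorphism class of objects. -/
noncomputable def rep (g : Quotient (isIsomorphicSetoid C)) : C := g.out

theorem nonempty_iso_rep_mk (x : C) : Nonempty (x ≅ rep (Quotient.mk _ x)) :=
  (Quotient.mk_out (s := isIsomorphicSetoid C) x).map Iso.symm

theorem eq_of_rep_iso {g g' : Quotient (isIsomorphicSetoid C)} (h : Nonempty (rep g ≅ rep g')) :
    g = g' := by
  have := Quotient.sound (s := isIsomorphicSetoid C) h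
  simpa [rep] using this

variable [MonoidalCategory C]

/-! ### Translation of representatives by words -/

/-- The interchange that makes translation by a sum natural in both summands. -/
theorem whiskerLeft_tensorHom_comp {p q s x x' y y' : C} (f : x ⟶ x') (k : y ⟶ y')
    (a : p ⊗ x' ⟶ q) (b : q ⊗ y' ⟶ s) :
    p ◁ (f ⊗ₘ k) ≫ (α_ p x' y').inv ≫ a ▷ y' ≫ b =
      (α_ p x y).inv ≫ (p ◁ f ≫ a) ▷ y ≫ q ◁ k ≫ b := by
  rw [comp_whiskerRight, Category.assoc, ← whisker_exchange_assoc,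
    MonoidalCategory.tensorHom_def]
  simp

variable [CategoricalGroup C]

theorem rep_zero_eq {g g' : Quotient (isIsomorphicSetoid C)}
    (h : Nonempty (rep g ⊗ (Word.zero : Word C).obj ≅ rep g')) : g = g' :=
  eq_of_rep_iso (h.map fun e => (ρ_ _).symm ≪≫ e)

theorem rep_add_step {w t : Word C} {g g' : Quotient (isIsomorphicSetoid C)}
    (h : Nonempty (rep g ⊗ (w.add t).obj ≅ rep g')) :
    Nonempty (rep (Quotient.mk _ (rep g ⊗ w.obj)) ⊗ t.obj ≅ rep g') := by
  obtain ⟨e⟩ := h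
  obtain ⟨k⟩ := nonempty_iso_rep_mk (rep g ⊗ w.obj)
  exact ⟨whiskerRightIso k.symm t.obj ≪≫ α_ _ _ _ ≪≫ e⟩

theorem rep_neg_step {w : Word C} {g g' : Quotient (isIsomorphicSetoid C)}
    (h : Nonempty (rep g ⊗ w.neg.obj ≅ rep g')) : Nonempty (rep g' ⊗ w.obj ≅ rep g) := by
  obtain ⟨e⟩ := h
  exact ⟨whiskerRightIso e.symm w.obj ≪≫ α_ _ _ _ ≪≫ whiskerLeftIso _ (ε w.obj) ≪≫ ρ_ _⟩

/-- A morphism `rep g ⊗ |w| ⟶ rep g'` attached to a word `w`, whenever the two objects are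
isomorphic. It is an arbitrary choice on the one-letter words, and is then determined by recursion
on `w`; the existence of an isomorphism is a hypothesis, rather than `g'` a function of `g` and `w`,
so that no transport along equalities of classes is needed. -/
noncomputable def translate : (w : Word C) → (g g' : Quotient (isIsomorphicSetoid C)) →
    Nonempty (rep g ⊗ w.obj ≅ rep g') → (rep g ⊗ w.obj ⟶ rep g')
  | .of _, _, _, h => h.some.hom
  | .zero, g, _, h => (ρ_ (rep g)).hom ≫ eqToHom (congrArg rep (rep_zero_eq h))
  | .add w t, g, g', h =>
      (α_ (rep g) w.obj t.obj).inv ≫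
        translate w g (Quotient.mk _ (rep g ⊗ w.obj)) (nonempty_iso_rep_mk _) ▷ t.obj ≫
          translate t _ g' (rep_add_step h)
  | .neg w, g, g', h =>
      Groupoid.inv (translate w g' g (rep_neg_step h)) ▷ neg w.obj ≫
        (α_ (rep g') w.obj (neg w.obj)).hom ≫ rep g' ◁ (δ w.obj).hom ≫ (ρ_ (rep g')).hom

theorem translate_zero (g : Quotient (isIsomorphicSetoid C))
    (h : Nonempty (rep g ⊗ (Word.zero : Word C).obj ≅ rep g)) :
    translate .zero g g h = (ρ_ (rep g)).hom := by
  simp only [translate, eqToHom_refl]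
  exact Category.comp_id _

/-- The intermediate class in the recursion clause for a sum can be named freely. -/
theorem translate_add {w t : Word C} {g g₁ g' : Quotient (isIsomorphicSetoid C)}
    (h : Nonempty (rep g ⊗ (w.add t).obj ≅ rep g')) (hw : Nonempty (rep g ⊗ w.obj ≅ rep g₁))
    (ht : Nonempty (rep g₁ ⊗ t.obj ≅ rep g')) :
    translate (w.add t) g g' h =
      (α_ (rep g) w.obj t.obj).inv ≫ translate w g g₁ hw ▷ t.obj ≫ translate t g₁ g' ht := by
  obtain rfl : Quotient.mk _ (rep g ⊗ w.obj) = g₁ := by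
    obtain ⟨e⟩ := nonempty_iso_rep_mk (rep g ⊗ w.obj)
    exact eq_of_rep_iso (hw.map fun k => e.symm ≪≫ k)
  rfl

theorem translate_neg {w : Word C} {g g' : Quotient (isIsomorphicSetoid C)}
    (h : Nonempty (rep g ⊗ w.neg.obj ≅ rep g')) (hw : Nonempty (rep g' ⊗ w.obj ≅ rep g)) :
    translate w.neg g g' h = Groupoid.inv (translate w g' g hw) ▷ neg w.obj ≫
        (α_ (rep g') w.obj (neg w.obj)).hom ≫ rep g' ◁ (δ w.obj).hom ≫ (ρ_ (rep g')).hom :=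
  rfl

/-! ### Consequences of the triangle identity -/

/-- The left triangle identity, with `δ` moved to the other side. -/
theorem δ_whiskerRight_comp_leftUnitor (x : C) :
    (δ x).hom ▷ x ≫ (λ_ x).hom = (α_ x (neg x) x).hom ≫ x ◁ (ε x).hom ≫ (ρ_ x).hom := by
  have h := congrArg (fun f => (δ x).hom ▷ x ≫ f ≫ (ρ_ x).hom) (triangle_left x)
  simpa using h.symm

/-- The left triangle identity, tensored on the left with `a`. -/
theorem whiskerLeft_triangle_left (a x : C) :
    (α_ (a ⊗ x) (neg x) x).inv ≫ ((α_ a x (neg x)).hom ≫ a ◁ (δ x).hom ≫ (ρ_ a).hom) ▷ x =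
      (a ⊗ x) ◁ (ε x).hom ≫ (ρ_ (a ⊗ x)).hom := by
  rw [← cancel_epi ((α_ (a ⊗ x) (neg x) x).hom), Iso.hom_inv_id_assoc]
  have e1 : ((α_ a x (neg x)).hom ≫ a ◁ (δ x).hom ≫ (ρ_ a).hom) ▷ x =
      (α_ a x (neg x)).hom ▷ x ≫ (α_ a (x ⊗ neg x) x).hom ≫
        a ◁ ((δ x).hom ▷ x ≫ (λ_ x).hom) := by
    simp
  rw [e1, δ_whiskerRight_comp_leftUnitor]
  simp

/-- Naturality of translation in `ε`, where `a` is the translation by `x`. -/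
theorem whiskerLeft_ε_comp_rightUnitor {p q x : C} (a : q ⊗ x ⟶ p) :
    p ◁ (ε x).hom ≫ (ρ_ p).hom = (α_ p (neg x) x).inv ≫
      (Groupoid.inv a ▷ neg x ≫ (α_ q x (neg x)).hom ≫ q ◁ (δ x).hom ≫ (ρ_ q).hom) ▷ x ≫ a := by
  have h := whiskerLeft_triangle_left q x
  rw [comp_whiskerRight, Category.assoc, ← associator_inv_naturality_left_assoc, reassoc_of% h,
    ← whisker_exchange_assoc]
  simp

/-- Naturality of translation in `δ`, where `a` is the translation by `x`. -/
theorem whiskerLeft_δ_comp_rightUnitor {p q x : C} (a : p ⊗ x ⟶ q) :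
    p ◁ (δ x).hom ≫ (ρ_ p).hom = (α_ p x (neg x)).inv ≫ a ▷ neg x ≫
      Groupoid.inv a ▷ neg x ≫ (α_ p x (neg x)).hom ≫ p ◁ (δ x).hom ≫ (ρ_ p).hom := by
  rw [← comp_whiskerRight_assoc]
  simp

/-! ### Coherence -/

/-- Translation is natural in special isomorphisms. -/
theorem Special.whiskerLeft_comp_translate {w w' : Word C} {f : w.obj ⟶ w'.obj}
    (hf : Special w w' f) (g g' : Quotient (isIsomorphicSetoid C))
    (h : Nonempty (rep g ⊗ w.obj ≅ rep g')) (h' : Nonempty (rep g ⊗ w'.obj ≅ rep g')) :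
    rep g ◁ f ≫ translate w' g g' h' = translate w g g' h := by
  induction hf generalizing g g' with
  | id w => simp
  | @comp w w' w'' f k _ _ ihf ihk =>
    have hm : Nonempty (rep g ⊗ w'.obj ≅ rep g') :=
      h.map fun e => whiskerLeftIso _ ((Groupoid.isoEquivHom _ _).symm f).symm ≪≫ e
    rw [MonoidalCategory.whiskerLeft_comp, Category.assoc, ihk g g' hm h', ihf g g' h hm]
  | inv _ ih =>
    rw [← ih g g' h' h, ← Category.assoc, ← MonoidalCategory.whiskerLeft_comp]
    simp
  | @sum w w' t t' f k _ _ ihf ihk =>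
    have hw := nonempty_iso_rep_mk (rep g ⊗ w.obj)
    have hw' : Nonempty (rep g ⊗ w'.obj ≅ rep (Quotient.mk _ (rep g ⊗ w.obj))) :=
      hw.map fun e => whiskerLeftIso _ ((Groupoid.isoEquivHom _ _).symm f).symm ≪≫ e
    have ht := rep_add_step h
    have ht' : Nonempty (rep (Quotient.mk _ (rep g ⊗ w.obj)) ⊗ t'.obj ≅ rep g') :=
      ht.map fun e => whiskerLeftIso _ ((Groupoid.isoEquivHom _ _).symm k).symm ≪≫ e
    rw [translate_add h' hw' ht', translate_add h hw ht, ← ihf g _ hw hw', ← ihk _ g' ht ht']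
    exact whiskerLeft_tensorHom_comp _ _ _ _
  | assoc w t s =>
    have hw := nonempty_iso_rep_mk (rep g ⊗ w.obj)
    have hts := rep_add_step h'
    have ht := nonempty_iso_rep_mk (rep (Quotient.mk _ (rep g ⊗ w.obj)) ⊗ t.obj)
    have hs := rep_add_step hts
    have hwt : Nonempty (rep g ⊗ (w.add t).obj ≅
        rep (Quotient.mk _ (rep (Quotient.mk _ (rep g ⊗ w.obj)) ⊗ t.obj))) := by
      obtain ⟨e⟩ := hw
      exact ht.map fun k => (α_ _ _ _).symm ≪≫ whiskerRightIso e _ ≪≫ k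
    rw [translate_add h' hw hts, translate_add hts ht hs, translate_add h hwt hs,
      translate_add hwt hw ht]
    simp [Word.obj]
  | zero_add w =>
    rw [translate_add h (⟨ρ_ _⟩ : Nonempty (rep g ⊗ (Word.zero : Word C).obj ≅ rep g)) h',
      translate_zero]
    simp [Word.obj]
  | add_zero w =>
    rw [translate_add h h' (⟨ρ_ _⟩ : Nonempty (rep g' ⊗ (Word.zero : Word C).obj ≅ rep g')),
      translate_zero]
    simp [Word.obj]
  | neg_add w =>
    obtain rfl := rep_zero_eq h'
    have hn := nonempty_iso_rep_mk (rep g ⊗ w.neg.obj)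
    have hw := rep_add_step h
    rw [translate_add h hn hw, translate_zero, translate_neg hn hw]
    exact whiskerLeft_ε_comp_rightUnitor _
  | add_neg w =>
    obtain rfl := rep_zero_eq h'
    have hw := nonempty_iso_rep_mk (rep g ⊗ w.obj)
    have hn := rep_add_step h
    rw [translate_add h hw hn, translate_zero, translate_neg hn hw]
    exact whiskerLeft_δ_comp_rightUnitor _

/-- Coherence: two special isomorphisms between the same words are equal. -/
theorem Special.unique {w w' : Word C} {f f' : w.obj ⟶ w'.obj} (hf : Special w w' f)
    (hf' : Special w w' f') : f = f' := by
  let g : Quotient (isIsomorphicSetoid C) := Quotient.mk _ (𝟙_ C)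
  obtain ⟨e⟩ := nonempty_iso_rep_mk (𝟙_ C)
  have h := nonempty_iso_rep_mk (rep g ⊗ w.obj)
  have h' : Nonempty (rep g ⊗ w'.obj ≅ rep (Quotient.mk _ (rep g ⊗ w.obj))) :=
    h.map fun e => whiskerLeftIso _ ((Groupoid.isoEquivHom _ _).symm f).symm ≪≫ e
  -- Both `rep g ◁ f` and `rep g ◁ f'` become the translation by `w` after composing with the
  -- translation by `w'`; transporting along `e : 0 ≅ rep g` leaves `0 ◁ f = 0 ◁ f'`.
  have key := (hf.whiskerLeft_comp_translate g _ h h').trans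
    (hf'.whiskerLeft_comp_translate g _ h h').symm
  rw [cancel_mono] at key
  have key' : e.hom ▷ _ ≫ rep g ◁ f = e.hom ▷ _ ≫ rep g ◁ f' := by rw [key]
  rw [← whisker_exchange, ← whisker_exchange, cancel_mono] at key'
  exact (whiskerLeft_iff f f').1 key'

/-! ### Opposites of morphisms -/

theorem negHom_id (x : C) : negHom (𝟙 x) = 𝟙 (neg x) := by
  have := congrArg (fun f => (ρ_ (neg x)).inv ≫ f ≫ (λ_ (neg x)).hom) (triangle_right x)
  simpa [negHom] using this

/-- Naturality of `δ`. -/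
theorem tensorHom_negHom_comp_δ {x x' : C} (f : x ⟶ x') :
    (f ⊗ₘ negHom f) ≫ (δ x').hom = (δ x).hom := by
  -- The other triangle composite: cancelling `x` against `-x + x` is cancelling `x + (-x)` by `δ`.
  have h : ∀ y : C, x ◁ ((α_ (neg x) x y).inv ≫ (ε x).hom ▷ y ≫ (λ_ y).hom) =
      (α_ x (neg x) (x ⊗ y)).inv ≫ (δ x).hom ▷ (x ⊗ y) ≫ (λ_ (x ⊗ y)).hom := by
    intro y
    have e : (δ x).hom ▷ (x ⊗ y) ≫ (λ_ (x ⊗ y)).hom =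
        (α_ (x ⊗ neg x) x y).inv ≫ ((δ x).hom ▷ x ≫ (λ_ x).hom) ▷ y := by
      simp
    rw [e, δ_whiskerRight_comp_leftUnitor]
    simp
  rw [tensorHom_def']
  have h1 := h (neg x')
  have h2 : negHom f = (ρ_ (neg x)).inv ≫ neg x ◁ ((δ x').inv ≫ Groupoid.inv f ▷ neg x') ≫
    ((α_ (neg x) x (neg x')).inv ≫ (ε x).hom ▷ neg x' ≫ (λ_ (neg x')).hom) := by
    simp [negHom]
  rw [h2, MonoidalCategory.whiskerLeft_comp, MonoidalCategory.whiskerLeft_comp, h1]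
  simp only [Category.assoc]
  rw [associator_inv_naturality_right_assoc, whisker_exchange_assoc]
  simp [unitors_equal]

/-! ### The canonical special isomorphisms -/

theorem Special.iso_inv {w w' : Word C} {e : w.obj ≅ w'.obj} (h : Special w w' e.hom) :
    Special w' w e.inv := by
  simpa using h.inv

theorem special_sumCorr : Special Word.zero (Word.zero.add Word.zero) (sumCorr C) :=
  Special.iso_inv (w := Word.zero.add Word.zero) (w' := Word.zero) (Special.zero_add Word.zero)

theorem special_negCorr : Special Word.zero Word.zero.neg (negCorr C) :=
  (Special.iso_inv (w := Word.zero.add Word.zero.neg) (w' := Word.zero)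
    (Special.add_neg Word.zero)).comp (Special.zero_add Word.zero.neg)

theorem special_actCorr (r : C) :
    Special Word.zero ((Word.of r).add (Word.zero.add (Word.of r).neg)) (actCorr r) := by
  have h := (Special.id (Word.of r)).sum
    (Special.iso_inv (w := Word.zero.add (Word.of r).neg)
    (w' := (Word.of r).neg) (Special.zero_add (Word.of r).neg))
  rw [id_tensorHom] at h
  exact (Special.iso_inv (w := (Word.of r).add (Word.of r).neg) (w' := Word.zero)
    (Special.add_neg (Word.of r))).comp h

/-! ### The c-crossed module of arrows with domain the zero object -/

/-- Any two arrows out of `0` in a groupoid are isomorphic, by the identity of `0` and a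
comparison of the codomains. -/
theorem isConnectedCGroup_kerCGroup : IsConnectedCGroup (kerCGroup C) := fun c c' =>
  ⟨Arrow.isoMk (Iso.refl _) ((Groupoid.isoEquivHom _ _).symm (Groupoid.inv c.hom ≫ c'.hom))
    (by simp [Groupoid.isoEquivHom])⟩

/-- The second crossed module identity holds strictly: by naturality of `δ` its inverse at `∂a`,
which enters `actCorr (∂a)`, is its inverse at `0` followed by `a + (-a)`. -/
theorem kerAct_kerD_eq (a a₁ : CKer C) : kerAct C (kerD C a) a₁ =
    (kerCGroup C).add a ((kerCGroup C).add a₁ ((kerCGroup C).neg a)) := by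
  have h := tensorHom_negHom_comp_δ a.hom
  have h' : (δ a.cod).inv = (δ (𝟙_ C)).inv ≫ (a.hom ⊗ₘ negHom a.hom) := by
    rw [← cancel_mono (δ a.cod).hom, Category.assoc, h]
    simp
  ext
  · rfl
  · -- The two codomains agree definitionally.
    apply heq_of_eq
    dsimp only [kerAct, kerCGroup, kerD, actCorr, sumCorr, negCorr]
    have e : (δ (𝟙_ C)).inv =
        (λ_ (𝟙_ C)).inv ≫ 𝟙_ C ◁ ((δ (𝟙_ C)).inv ≫ (λ_ (neg (𝟙_ C))).hom) := by
      rw [← leftUnitor_inv_naturality]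
      simp
    rw [negHom_id, h']
    generalize (δ (𝟙_ C)).inv ≫ (λ_ (neg (𝟙_ C))).hom = k at e ⊢
    have e' : (λ_ (𝟙_ C)).inv ≫ (a₁.hom ⊗ₘ k ≫ negHom a.hom) =
        k ≫ negHom a.hom ≫ (λ_ (neg a.cod)).inv ≫ a₁.hom ▷ neg a.cod := by
      rw [tensorHom_def', ← leftUnitor_inv_naturality_assoc, Category.assoc]
    rw [e, e', id_tensorHom, tensorHom_id]
    simp only [MonoidalCategory.tensorHom_def, Category.assoc,
      MonoidalCategory.whiskerLeft_comp, whisker_exchange_assoc]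

theorem isCGroup_objCGroup : IsCGroup (objCGroup C) where
  equivalence := ⟨fun x => ⟨Iso.refl x⟩, fun ⟨e⟩ => ⟨e.symm⟩, fun ⟨e⟩ ⟨k⟩ => ⟨e ≪≫ k⟩⟩
  add_congr := fun ⟨e⟩ ⟨k⟩ => ⟨e ⊗ᵢ k⟩
  add_assoc x y z := ⟨(α_ x y z).symm⟩
  add_zero x := ⟨ρ_ x⟩
  zero_add x := ⟨λ_ x⟩
  add_neg x := ⟨δ x⟩
  neg_add x := ⟨ε x⟩

theorem isCCrossedModule_ker :
    IsCCrossedModule (kerCGroup C) (objCGroup C) (kerD C) (kerAct C) where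
  isCGroup_left :=
    { equivalence := ⟨fun _ => ⟨Iso.refl _⟩, fun ⟨e⟩ => ⟨e.symm⟩, fun ⟨e⟩ ⟨k⟩ => ⟨e ≪≫ k⟩⟩
      add_congr := fun _ _ => isConnectedCGroup_kerCGroup _ _
      add_assoc := fun _ _ _ => isConnectedCGroup_kerCGroup _ _
      add_zero := fun _ => isConnectedCGroup_kerCGroup _ _
      zero_add := fun _ => isConnectedCGroup_kerCGroup _ _
      add_neg := fun _ => isConnectedCGroup_kerCGroup _ _
      neg_add := fun _ => isConnectedCGroup_kerCGroup _ _ }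
  isCGroup_right := isCGroup_objCGroup
  isCGroupHom := ⟨fun ⟨e⟩ => ⟨Arrow.rightFunc.mapIso e⟩, fun _ _ => rfl⟩
  isCAction :=
    { act_add := fun _ _ _ => isConnectedCGroup_kerCGroup _ _
      add_act := fun _ _ _ => isConnectedCGroup_kerCGroup _ _
      zero_act := fun _ => isConnectedCGroup_kerCGroup _ _
      act_congr := fun _ _ => isConnectedCGroup_kerCGroup _ _ }
  bd_act _ _ := rfl
  bd_act_rel _ _ := isConnectedCGroup_kerCGroup _ _

/-! ### Lifting of isomorphisms -/

/-- By coherence the domain part of an isomorphism over `σ` is the identity. -/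
theorem kerOver_iff {c c' : CKer C} {σ : kerD C c ⟶ kerD C c'} :
    KerOver c c' σ ↔ c.hom ≫ σ = c'.hom := by
  constructor
  · rintro ⟨θ, ⟨_, _, hs⟩, rfl⟩
    have h1 : θ.hom.left = 𝟙 (𝟙_ C) := by
      -- The `eqToHom`s in `hs` are identities, as the value of the word `0` is `𝟙_ C` by definition.
      have hs' : 𝟙 (𝟙_ C) ≫ θ.hom.left ≫ 𝟙 (𝟙_ C) = 𝟙 (𝟙_ C) := hs.unique (Special.id Word.zero)
      simpa using hs'
    have hw := Arrow.w θ.hom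
    rw [h1] at hw
    exact hw.symm.trans (Category.id_comp _)
  · intro h
    refine ⟨Arrow.isoMk (Iso.refl _) ((Groupoid.isoEquivHom _ _).symm σ)
      ((Category.id_comp _).trans h.symm), ⟨rfl, rfl, ?_⟩, rfl⟩
    -- `eqToHom` of an equality of definitionally equal objects is an identity.
    have h0 : 𝟙 (𝟙_ C) ≫ 𝟙 (𝟙_ C) ≫ 𝟙 (𝟙_ C) = 𝟙 (𝟙_ C) := by simp
    have hs := Special.id (C := C) Word.zero
    exact h0.symm ▸ hs

theorem isSpecialCCrossedModule_ker :
    IsSpecialCCrossedModule (kerCGroup C) (kerD C) (KerOver (C := C)) where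
  exists_lift a r γ := ⟨⟨r, a.hom ≫ γ⟩, isConnectedCGroup_kerCGroup _ _, rfl,
    kerOver_iff.2 (congrArg (a.hom ≫ ·) (Category.comp_id γ))⟩
  existsUnique_lift a r γ t t' hγ := by
    refine ⟨⟨r, a.hom ≫ γ⟩, ⟨rfl, γ, kerOver_iff.2 rfl, hγ⟩, ?_⟩
    rintro ⟨_, k⟩ ⟨rfl, σ, hσ, hx, hy, hs⟩
    obtain ⟨_, _, hγs⟩ := hγ
    obtain rfl : σ = γ := by
      have := hs.unique hγs
      rwa [cancel_epi, cancel_mono] at this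
    rw [kerOver_iff] at hσ
    exact congrArg (CKer.mk _) hσ.symm

end

end CategoricalGroup

open CategoricalGroup in
theorem mainTheorem1 (C : Type u) [Groupoid.{v} C] [MonoidalCategory C] [CategoricalGroup C] :
    -- the isomorphisms used in the operations are the unique special isomorphisms
    (∀ γ : 𝟙_ C ⟶ 𝟙_ C ⊗ 𝟙_ C,
      Special Word.zero (Word.zero.add Word.zero) γ ↔ γ = sumCorr C) ∧
    (∀ γ : 𝟙_ C ⟶ neg (𝟙_ C), Special Word.zero Word.zero.neg γ ↔ γ = negCorr C) ∧
    (∀ (r : C) (γ : 𝟙_ C ⟶ r ⊗ (𝟙_ C ⊗ neg r)),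
      Special Word.zero ((Word.of r).add (Word.zero.add (Word.of r).neg)) γ ↔ γ = actCorr r) ∧
    -- the triple is a connected, strict and special c-crossed module
    IsCCrossedModule (kerCGroup C) (objCGroup C) (kerD C) (kerAct C) ∧
    IsConnectedCGroup (kerCGroup C) ∧
    IsStrictCCrossedModule (kerCGroup C) (objCGroup C) (kerD C) (kerAct C) ∧
    IsSpecialCCrossedModule (kerCGroup C) (kerD C) KerOver :=
  ⟨fun _ => ⟨fun h => h.unique special_sumCorr, fun h => h ▸ special_sumCorr⟩,
    fun _ => ⟨fun h => h.unique special_negCorr, fun h => h ▸ special_negCorr⟩,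
    fun r _ => ⟨fun h => h.unique (special_actCorr r), fun h => h ▸ special_actCorr r⟩,
    isCCrossedModule_ker, isConnectedCGroup_kerCGroup, ⟨fun _ _ => rfl, kerAct_kerD_eq⟩,
    isSpecialCCrossedModule_ker⟩
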